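/- Let $k$ be a field. A quiver $A_{\mathbb R}$ of continuous type $A$ is given by a subset $S\subset\mathbb R$ without accumulation points (possibly empty), and an increasing indexing $n\mapsto s_n$ of $S\cup\{\pm\infty\}$ by an order-convex subset of $\mathbb Z\cup\{\pm\infty\}$ containing $0$. Its orientation is the partial order $\preceq$ on $\mathbb R\cup\{\pm\infty\}$ in which every point is related to itself and, for distinct $x$ and $y$, $x\preceq y$ holds if and only if there is $n\in\mathbb Z$ such that $n$ and $n+1$ are indices, $x,y\in[s_n,s_{n+1}]$, and either $n$ is even and $x\le y$, or $n$ is odd and $y\le x$. (Thus $s_n$ is a sink for $n$ even and a source for $n$ odd.) A representation $V$ of $A_{\mathbb R}$ assigns a $k$-vector space $V(x)$ to each $x\in\mathbb R$ and a linear map $V(x,y):V(x)\to V(y)$ to each pair with $y\preceq x$, such that $V(x,x)=\mathrm{id}$ and $V(y,z)\circ V(x,y)=V(x,z)$ for $z\preceq y\preceq x$; morphisms are families of linear maps commuting with these. Let $\mathrm{Rep}_k^{\mathrm{pwf}}(A_{\mathbb R})$ be the full subcategory of the representations with $\dim_k V(x)<\infty$ for all $x\in\mathbb R$. For a subset $D\subseteq\mathbb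 R$ such that $y\preceq x\in D$ implies $y\in D$, let $P_D$ be the representation with $P_D(x)=k$ for $x\in D$ and $P_D(x)=0$ otherwise, where $P_D(x,y)=1_k$ if $y\preceq x\in D$, and $P_D(x,y)=0$ if $y\preceq x\notin D$. Put $$P_a=P_{\{x\in\mathbb R\,:\,x\preceq a\}}\ (a\in\mathbb R),\qquad P_{a)}=P_{\{x\in\mathbb R\,:\,x\preceq a,\ x<a\}},\qquad P_{(a}=P_{\{x\in\mathbb R\,:\,x\preceq a,\ a<x\}}\ (a\in\mathbb R\cup\{\pm\infty\}).$$ Theorem. Every indecomposable projective object of $\mathrm{Rep}_k^{\mathrm{pwf}}(A_{\mathbb R})$ is isomorphic to $P_a$ for some $a\in\mathbb R$, or to $P_{a)}$ or $P_{(a}$ for some $a\in\mathbb R\cup\{\pm\infty\}$. Conversely, each of these representations that is nonzero is an indecomposable projective object of $\mathrm{Rep}_k^{\mathrm{pwf}}(A_{\mathbb R})$. -/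

import Mathlib

open CategoryTheory CategoryTheory.Limits

universe u

/-- A quiver of continuous type `A`: a subset `S ⊆ ℝ` without accumulation points, together with
an indexing `n ↦ s n` of `S ∪ {±∞}`, increasing, by an order-convex subset `index` of
`ℤ ∪ {±∞}` that contains `0`.  The values of `s` outside `index` play no role. -/
structure ContinuousTypeA where
  /-- The set of (finite) sinks and sources. -/
  S : Set ℝ
  not_accPt : ∀ x : ℝ, ¬ AccPt x (Filter.principal S)
  /-- The set of indices in use. -/
  index : Set EInt
  /-- The point `s n` of `S ∪ {±∞}` with index `n`. -/
  s : EInt → EReal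
  strictMonoOn_s : StrictMonoOn s index
  image_s : s '' index = ((↑) : ℝ → EReal) '' S ∪ {⊥, ⊤}
  zero_mem : ((0 : ℤ) : EInt) ∈ index
  ordConnected : index.OrdConnected

namespace ContinuousTypeA

variable (A : ContinuousTypeA)

/-- `A.Segment n x` : the integers `n` and `n + 1` are indices, and `s n ≤ x ≤ s (n + 1)`. -/
def Segment (n : ℤ) (x : EReal) : Prop :=
  (n : EInt) ∈ A.index ∧ ((n + 1 : ℤ) : EInt) ∈ A.index ∧
    A.s (n : EInt) ≤ x ∧ x ≤ A.s ((n + 1 : ℤ) : EInt)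

/-- The orientation `x ⪯ y` on `ℝ ∪ {±∞}`: on a segment `[s n, s (n + 1)]` it is `x ≤ y` if `n` is
even and `y ≤ x` if `n` is odd (so `s n` is a sink for `n` even and a source for `n` odd), and
points that do not lie on a common segment are not related. -/
def Prec (x y : EReal) : Prop :=
  x = y ∨ ∃ n : ℤ, A.Segment n x ∧ A.Segment n y ∧ ((Even n ∧ x ≤ y) ∨ (Odd n ∧ y ≤ x))

variable {A}

lemma Segment.eq_of_lt {n m : ℤ} {y : EReal} (hn : A.Segment n y) (hm : A.Segment m y)
    (h : n < m) : m = n + 1 ∧ y = A.s (m : EInt) := by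
  have h1 : A.s (m : EInt) ≤ A.s ((n + 1 : ℤ) : EInt) := hm.2.2.1.trans hn.2.2.2
  have h2 : m ≤ n + 1 := by
    simpa using (A.strictMonoOn_s.le_iff_le hm.1 hn.2.1).1 h1
  obtain rfl : m = n + 1 := by omega
  exact ⟨rfl, le_antisymm hn.2.2.2 hm.2.2.1⟩

lemma Prec.trans {x y z : EReal} (hxy : A.Prec x y) (hyz : A.Prec y z) : A.Prec x z := by
  rcases hxy with rfl | ⟨n, hnx, hny, h⟩
  · exact hyz
  rcases hyz with rfl | ⟨m, hmy, hmz, h'⟩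
  · exact Or.inr ⟨n, hnx, hny, h⟩
  rcases lt_trichotomy n m with hnm | rfl | hnm
  · obtain ⟨rfl, hy⟩ := hny.eq_of_lt hmy hnm
    rcases h with ⟨he, -⟩ | ⟨ho, hle⟩
    · rcases h' with ⟨he', -⟩ | ⟨-, hle'⟩
      · exact absurd he' (by simpa [Int.even_add_one] using he)
      · obtain rfl : y = z := le_antisymm (hy.le.trans hmz.2.2.1) hle'
        exact Or.inr ⟨n, hnx, hny, Or.inl ⟨he, hnx.2.2.2.trans hy.ge⟩⟩
    · obtain rfl : x = y := le_antisymm (hnx.2.2.2.trans hy.ge) hle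
      exact Or.inr ⟨n + 1, hmy, hmz, h'⟩
  · rcases h with ⟨he, hle⟩ | ⟨ho, hle⟩ <;> rcases h' with ⟨he', hle'⟩ | ⟨ho', hle'⟩
    · exact Or.inr ⟨n, hnx, hmz, Or.inl ⟨he, hle.trans hle'⟩⟩
    · exact absurd he (Int.not_even_iff_odd.2 ho')
    · exact absurd he' (Int.not_even_iff_odd.2 ho)
    · exact Or.inr ⟨n, hnx, hmz, Or.inr ⟨ho, hle'.trans hle⟩⟩
  · obtain ⟨rfl, hy⟩ := hmy.eq_of_lt hny hnm
    rcases h with ⟨he, hle⟩ | ⟨ho, hle⟩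
    · obtain rfl : x = y := le_antisymm hle (hy.le.trans hnx.2.2.1)
      exact Or.inr ⟨m, hmy, hmz, h'⟩
    · rcases h' with ⟨he', hle'⟩ | ⟨ho', -⟩
      · obtain rfl : y = z := le_antisymm hle' (hmz.2.2.2.trans hy.ge)
        exact Or.inr ⟨m + 1, hnx, hny, Or.inr ⟨ho, hle⟩⟩
      · exact absurd ho (by simpa [Int.even_add_one, ← Int.not_even_iff_odd] using ho')

lemma Prec.antisymm {x y : EReal} (hxy : A.Prec x y) (hyx : A.Prec y x) : x = y := by
  rcases hxy with rfl | ⟨n, hnx, hny, h⟩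
  · rfl
  rcases hyx with rfl | ⟨m, hmy, hmx, h'⟩
  · rfl
  rcases lt_trichotomy n m with hnm | rfl | hnm
  · exact (hnx.eq_of_lt hmx hnm).2.trans (hny.eq_of_lt hmy hnm).2.symm
  · rcases h with ⟨he, hle⟩ | ⟨ho, hle⟩ <;> rcases h' with ⟨he', hle'⟩ | ⟨ho', hle'⟩
    · exact le_antisymm hle hle'
    · exact absurd he (Int.not_even_iff_odd.2 ho')
    · exact absurd he' (Int.not_even_iff_odd.2 ho)
    · exact le_antisymm hle' hle
  · exact (hmx.eq_of_lt hnx hnm).2.trans (hmy.eq_of_lt hny hnm).2.symm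

/-- If `y ⪯ x ⪯ a` and `x < a`, then `y < a`. -/
lemma Prec.lt_of_lt {x y a : EReal} (hyx : A.Prec y x) (hxa : A.Prec x a) (h : x < a) :
    y < a := by
  rcases hyx with rfl | ⟨m, hmy, hmx, h'⟩
  · exact h
  rcases h' with ⟨-, hle⟩ | ⟨ho, hle⟩
  · exact hle.trans_lt h
  rcases hxa with rfl | ⟨n, hnx, hna, h''⟩
  · exact absurd h (lt_irrefl _)
  rcases h'' with ⟨he, -⟩ | ⟨-, hle'⟩
  · rcases lt_trichotomy n m with hnm | rfl | hnm
    · obtain ⟨rfl, hx⟩ := hnx.eq_of_lt hmx hnm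
      exact absurd (hna.2.2.2.trans hx.ge) (not_le.2 h)
    · exact absurd he (Int.not_even_iff_odd.2 ho)
    · obtain ⟨rfl, hx⟩ := hmx.eq_of_lt hnx hnm
      exact (hmy.2.2.2.trans hx.ge).trans_lt h
  · exact absurd hle' (not_le.2 h)

/-- If `y ⪯ x ⪯ a` and `a < x`, then `a < y`. -/
lemma Prec.gt_of_gt {x y a : EReal} (hyx : A.Prec y x) (hxa : A.Prec x a) (h : a < x) :
    a < y := by
  rcases hyx with rfl | ⟨m, hmy, hmx, h'⟩
  · exact h
  rcases h' with ⟨he, hle⟩ | ⟨-, hle⟩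
  · rcases hxa with rfl | ⟨n, hnx, hna, h''⟩
    · exact absurd h (lt_irrefl _)
    rcases h'' with ⟨-, hle'⟩ | ⟨ho, -⟩
    · exact absurd hle' (not_le.2 h)
    rcases lt_trichotomy n m with hnm | rfl | hnm
    · obtain ⟨rfl, hx⟩ := hnx.eq_of_lt hmx hnm
      exact h.trans_le (hx.le.trans hmy.2.2.1)
    · exact absurd he (Int.not_even_iff_odd.2 ho)
    · obtain ⟨rfl, hx⟩ := hmx.eq_of_lt hnx hnm
      exact absurd (hx.le.trans hna.2.2.1) (not_le.2 h)
  · exact h.trans_le hle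

variable (A)

/-- The points of the quiver: real numbers, ordered by the orientation `⪯`. -/
@[ext]
structure Pt (A : ContinuousTypeA) where
  val : ℝ

instance : PartialOrder A.Pt where
  le x y := A.Prec (x.val : EReal) (y.val : EReal)
  le_refl _ := Or.inl rfl
  le_trans _ _ _ := Prec.trans
  le_antisymm _ _ h h' := Pt.ext (EReal.coe_injective (Prec.antisymm h h'))

variable (k : Type u) [Field k]

/-- Representations of the quiver: a vector space `V(x)` for every point `x`, and a linear map
`V(x, y) : V(x) → V(y)` whenever `y ⪯ x`, functorially; morphisms are natural transformations. -/
abbrev Rep := A.Ptᵒᵖ ⥤ ModuleCat.{u} k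

/-- Pointwise finite-dimensional representations. -/
def pwf : ObjectProperty (A.Rep k) :=
  fun V => ∀ x : A.Pt, FiniteDimensional k (V.obj (Opposite.op x))

/-- The category of pointwise finite-dimensional representations. -/
abbrev RepPwf := (A.pwf k).FullSubcategory

instance : (A.pwf k).IsClosedUnderLimitsOfShape (Discrete WalkingPair) where
  limitsOfShape_le := by
    rintro V ⟨p⟩ x
    let E := (evaluation A.Ptᵒᵖ (ModuleCat.{u} k)).obj (Opposite.op x)
    have hl := isLimitOfPreserves E p.isLimit
    have (j : Discrete WalkingPair) :
        FiniteDimensional k ((p.diag.obj j).obj (Opposite.op x)) := p.prop_diag_obj j x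
    let f : V.obj (Opposite.op x) →ₗ[k]
        ((p.diag.obj ⟨WalkingPair.left⟩).obj (Opposite.op x) ×
          (p.diag.obj ⟨WalkingPair.right⟩).obj (Opposite.op x)) :=
      LinearMap.prod ((p.π.app ⟨WalkingPair.left⟩).app (Opposite.op x)).hom
        ((p.π.app ⟨WalkingPair.right⟩).app (Opposite.op x)).hom
    refine FiniteDimensional.of_injective f ?_
    intro v w hvw
    apply Concrete.isLimit_ext _ hl
    rintro ⟨_ | _⟩
    · exact congrArg Prod.fst hvw
    · exact congrArg Prod.snd hvw

instance : HasBinaryBiproducts (A.RepPwf k) :=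
  HasBinaryBiproducts.of_hasBinaryProducts

variable {A}

open Classical in
/-- `k` (as the submodule `⊤` of `k`) if `x ∈ D`, and `0` otherwise. -/
noncomputable def fiber (D : LowerSet A.Pt) (x : A.Pt) : Submodule k k :=
  if x ∈ D then ⊤ else ⊥

lemma fiber_mono (D : LowerSet A.Pt) {x y : A.Pt} (h : y ≤ x) : fiber k D x ≤ fiber k D y := by
  unfold fiber
  by_cases hx : x ∈ D
  · rw [if_pos (show y ∈ D from D.lower h hx)]
    exact le_top
  · rw [if_neg hx]
    exact bot_le

/-- The representation which is `k` on the `⪯`-lower set `D` and `0` elsewhere, all of whose maps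
between copies of `k` are the identity. -/
noncomputable def lowerRep (D : LowerSet A.Pt) : A.Rep k where
  obj x := ModuleCat.of k (fiber k D x.unop)
  map f := ModuleCat.ofHom (Submodule.inclusion (fiber_mono k D (leOfHom f.unop)))
  map_id _ := rfl
  map_comp _ _ := rfl

lemma pwf_lowerRep (D : LowerSet A.Pt) : A.pwf k (lowerRep k D) := fun x => by
  unfold lowerRep
  dsimp only
  infer_instance

variable (A)

/-- The lower set `{x | x ⪯ a}`. -/
def down (a : ℝ) : LowerSet A.Pt where
  carrier := {x | A.Prec (x.val : EReal) (a : EReal)}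
  lower' _ _ hyx hx := Prec.trans hyx hx

/-- The lower set `{x | x ⪯ a, x < a}`. -/
def downLeft (a : EReal) : LowerSet A.Pt where
  carrier := {x | A.Prec (x.val : EReal) a ∧ (x.val : EReal) < a}
  lower' _ _ hyx hx := ⟨Prec.trans hyx hx.1, Prec.lt_of_lt hyx hx.1 hx.2⟩

/-- The lower set `{x | x ⪯ a, a < x}`. -/
def downRight (a : EReal) : LowerSet A.Pt where
  carrier := {x | A.Prec (x.val : EReal) a ∧ a < (x.val : EReal)}
  lower' _ _ hyx hx := ⟨Prec.trans hyx hx.1, Prec.gt_of_gt hyx hx.1 hx.2⟩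

/-- `P_a`, for `a` real. -/
noncomputable def P (a : ℝ) : A.RepPwf k := ⟨lowerRep k (A.down a), pwf_lowerRep k _⟩

/-- `P_{a)}`, for `a` in `ℝ ∪ {±∞}`. -/
noncomputable def PLeft (a : EReal) : A.RepPwf k :=
  ⟨lowerRep k (A.downLeft a), pwf_lowerRep k _⟩

/-- `P_{(a}`, for `a` in `ℝ ∪ {±∞}`. -/
noncomputable def PRight (a : EReal) : A.RepPwf k :=
  ⟨lowerRep k (A.downRight a), pwf_lowerRep k _⟩

end ContinuousTypeA

/-!
The representations `P_a`, `P_{a)}`, `P_{(a}` that are nonzero are the `P_D` for `D` a nonempty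
directed lower set (`eq_down_of_directedOn`, `directedOn_down`, `directedOn_downLeft`,
`directedOn_downRight`).  So it has to be shown that the indecomposable projective objects are these
`P_D`.

*`P_D` is projective* (`projective_lowerObj`).  A morphism `P_D ⟶ X` is an element of the inverse
limit of `X` over `D`, so surjectivity on inverse limits is needed for a pointwise surjective
`E ⟶ X` between pointwise finite-dimensional representations.  Choose arbitrary lifts
`c z ∈ E(z)`, `z ∈ D`, transport them down to a fixed `E(x)`, and take a generalized limit along
`z → ∞` in `D`: a linear functional on families of scalars that depends only on germs and
preserves constants, extended to finite-dimensional spaces by duality (`vectorLimit`).  It commutes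
with linear maps, so the limits form a compatible family that lifts the given one.

*`P_D` is indecomposable* (`indecomposable_lowerObj`), as its endomorphisms are scalars.

*Every indecomposable projective `V` is some `P_D`* (`exists_iso_lowerObj`).  Take a nonzero
functional `φ` on some `V(b)`, and let `U` be the set of the `x` above `b` for which `φ` is nonzero
on the image of `V(x)`.  The points above a point that is not a sink form a chain, so if `b` is not
a sink, `U` is a chain and generates a directed lower set `D`; if `V` lives on the sinks only,
`U = {b}`.  The fibre product of `V` and `P_D` over the representation that is `k` on the points
above `b` maps onto `V`, and this epimorphism splits.  The resulting morphism `V ⟶ P_D` extends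
`φ`, hence is an epimorphism, which splits because `P_D` is projective.  As `V` is indecomposable,
it is an isomorphism.
-/

namespace ContinuousTypeA

open Opposite

/-! ### Pointwise finite-dimensional representations -/

section Category

variable {k : Type u} [Field k] {A : ContinuousTypeA}

/-- The structure map `V(x, y) : V(x) → V(y)` of a representation, as a linear map. -/
abbrev tr (V : A.Rep k) {x y : A.Pt} (h : y ≤ x) : V.obj (op x) →ₗ[k] V.obj (op y) :=
  (V.map (homOfLE h).op).hom

lemma tr_self (V : A.Rep k) {x : A.Pt} (h : x ≤ x) (v : V.obj (op x)) : tr V h v = v := by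
  simp [tr]

lemma tr_tr (V : A.Rep k) {x y z : A.Pt} (h : y ≤ x) (h' : z ≤ y) (v : V.obj (op x)) :
    tr V h' (tr V h v) = tr V (h'.trans h) v := by
  have : (homOfLE (h'.trans h)).op = (homOfLE h).op ≫ (homOfLE h').op := rfl
  simp [tr, this]

lemma app_tr {V W : A.Rep k} (f : V ⟶ W) {x y : A.Pt} (h : y ≤ x) (v : V.obj (op x)) :
    (f.app (op y)).hom (tr V h v) = tr W h ((f.app (op x)).hom v) :=
  NatTrans.naturality_apply f (homOfLE h).op v

instance : (A.pwf k).IsClosedUnderSubobjects where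
  prop_of_mono f _ hY x := by
    have := hY x
    exact FiniteDimensional.of_injective (f.app (op x)).hom
      ((ModuleCat.mono_iff_injective _).1 inferInstance)

instance : (A.pwf k).IsClosedUnderQuotients where
  prop_of_epi f _ hX x := by
    have := hX x
    exact Module.Finite.of_surjective (f.app (op x)).hom
      ((ModuleCat.epi_iff_surjective _).1 inferInstance)

instance : (A.pwf k).ContainsZero where
  exists_zero := by
    obtain ⟨Z, hZ⟩ := HasZeroObject.zero (C := A.Rep k)
    refine ⟨Z, hZ, fun x => ?_⟩
    have h : IsZero (Z.obj (op x)) :=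
      ((evaluation A.Ptᵒᵖ (ModuleCat.{u} k)).obj (op x)).map_isZero hZ
    have := ModuleCat.subsingleton_of_isZero h
    infer_instance

/-- Epimorphisms of pointwise finite-dimensional representations are the pointwise surjective
morphisms. -/
lemma epi_iff_surjective {V W : A.RepPwf k} (f : V ⟶ W) :
    Epi f ↔ ∀ x : A.Pt, Function.Surjective (f.hom.app (op x)).hom := by
  have key : Epi f.hom ↔ ∀ x : A.Pt, Function.Surjective (f.hom.app (op x)).hom := by
    simp only [NatTrans.epi_iff_epi_app, ModuleCat.epi_iff_surjective]
    exact ⟨fun h x => h (op x), fun h x => h x.unop⟩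
  rw [← key]
  constructor
  · intro h
    have := (A.pwf k).preservesEpimorphisms_ι_of_isNormalMonoCategory
    exact inferInstanceAs (Epi ((A.pwf k).ι.map f))
  · intro h
    exact (A.pwf k).ι.epi_of_epi_map h

/-- An epimorphism from an indecomposable object onto a nonzero projective one is invertible. -/
lemma nonempty_iso_of_epi {V W : A.RepPwf k} (hV : Indecomposable V) (hW : ¬ IsZero W)
    [Projective W] (f : V ⟶ W) [Epi f] : Nonempty (V ≅ W) := by
  have : IsSplitEpi f := ⟨⟨⟨Projective.factorThru (𝟙 W) f, Projective.factorThru_comp _ _⟩⟩⟩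
  have hb := isBilimitBinaryBiconeOfIsSplitEpiOfKernel (kernelIsKernel f)
  have hK : IsZero (kernel f) :=
    (hV.2 _ _ (biprod.uniqueUpToIso _ _ hb)).resolve_right hW
  have : Mono f := Preadditive.mono_of_isZero_kernel _ hK
  have := isIso_of_mono_of_isSplitEpi f
  exact ⟨asIso f⟩

lemma isZero_iff_subsingleton (V : A.RepPwf k) :
    IsZero V ↔ ∀ x : A.Pt, Subsingleton (V.obj.obj (op x)) := by
  constructor
  · intro h x
    have h' : IsZero V.obj := (A.pwf k).ι.map_isZero h
    exact ModuleCat.subsingleton_of_isZero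
      (((evaluation A.Ptᵒᵖ (ModuleCat.{u} k)).obj (op x)).map_isZero h')
  · intro h
    rw [IsZero.iff_id_eq_zero]
    ext x v
    exact (h x.unop).elim _ _

end Category

/-! ### Generalized limits -/

section GeneralizedLimit

variable {k : Type u} [Field k] {ι : Type*} (l : Filter ι)

open Filter

/-- A generalized limit: a linear functional on all families of scalars that depends only on the
germ of the family along `l` and sends constant families to their value. -/
lemma exists_generalizedLimit [l.NeBot] : ∃ L : (ι → k) →ₗ[k] k,
    (∀ f g : ι → k, f =ᶠ[l] g → L f = L g) ∧ ∀ c : k, L (fun _ => c) = c := by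
  let N : Submodule k (ι → k) :=
    { carrier := {f | f =ᶠ[l] 0}
      add_mem' := fun {f g} hf hg => by simpa using hf.add hg
      zero_mem' := EventuallyEq.rfl
      smul_mem' := fun c f hf => by simpa using hf.const_smul c }
  have h1 : (1 : ι → k) ∉ N := fun h => by
    obtain ⟨i, hi⟩ := (show (1 : ι → k) =ᶠ[l] 0 from h).exists
    exact one_ne_zero hi
  obtain ⟨L, hL1, hL⟩ := Submodule.exists_le_ker_of_notMem h1
  refine ⟨(L 1)⁻¹ • L, fun f g hfg => ?_, fun c => ?_⟩
  · have : f - g ∈ N := hfg.sub_eq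
    have := hL this
    rw [LinearMap.mem_ker, map_sub, sub_eq_zero] at this
    simp [this]
  · have : (fun _ => c : ι → k) = c • 1 := by ext; simp
    rw [this, map_smul, LinearMap.smul_apply, smul_eq_mul, smul_eq_mul, inv_mul_cancel₀ hL1,
      mul_one]

/-- The extension of a functional on families of scalars to families of vectors in a
finite-dimensional space: the vector whose image under each functional `φ` is the value of `L` at
the image of the family under `φ`. -/
noncomputable def vectorLimit (L : (ι → k) →ₗ[k] k) (E : Type*) [AddCommGroup E] [Module k E]
    [FiniteDimensional k E] (g : ι → E) : E :=
  (Module.evalEquiv k E).symm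
    { toFun := fun φ => L fun i => φ (g i)
      map_add' := fun φ ψ => by rw [← map_add]; rfl
      map_smul' := fun c φ => by rw [← map_smul]; rfl }

variable (L : (ι → k) →ₗ[k] k) {E F : Type*} [AddCommGroup E] [Module k E]
    [FiniteDimensional k E] [AddCommGroup F] [Module k F] [FiniteDimensional k F]

lemma apply_vectorLimit (g : ι → E) (φ : Module.Dual k E) :
    φ (vectorLimit L E g) = L fun i => φ (g i) := by
  simp [vectorLimit]

lemma map_vectorLimit (T : E →ₗ[k] F) (g : ι → E) :
    T (vectorLimit L E g) = vectorLimit L F fun i => T (g i) := by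
  refine Module.eval_apply_injective k (LinearMap.ext fun φ => ?_)
  rw [Module.Dual.eval_apply, Module.Dual.eval_apply]
  rw [apply_vectorLimit]
  exact apply_vectorLimit L g (φ ∘ₗ T)

variable {l L}

lemma vectorLimit_congr (hL : ∀ f g : ι → k, f =ᶠ[l] g → L f = L g) {f g : ι → E}
    (h : f =ᶠ[l] g) : vectorLimit L E f = vectorLimit L E g := by
  refine Module.eval_apply_injective k (LinearMap.ext fun φ => ?_)
  rw [Module.Dual.eval_apply, Module.Dual.eval_apply]
  rw [apply_vectorLimit, apply_vectorLimit]
  exact hL _ _ (h.fun_comp φ)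

lemma vectorLimit_const (hL : ∀ c : k, L (fun _ => c) = c) (v : E) :
    vectorLimit L E (fun _ => v) = v := by
  refine Module.eval_apply_injective k (LinearMap.ext fun φ => ?_)
  rw [Module.Dual.eval_apply, Module.Dual.eval_apply]
  rw [apply_vectorLimit, hL]

end GeneralizedLimit

/-! ### The representations attached to directed lower sets -/

section LowerSets

variable {k : Type u} [Field k] {A : ContinuousTypeA} {D : LowerSet A.Pt}

lemma mem_fiber {x : A.Pt} (hx : x ∈ D) (c : k) : c ∈ fiber k D x := by simp [fiber, hx]

lemma eq_zero_of_mem_fiber {x : A.Pt} (hx : x ∉ D) {c : k} (hc : c ∈ fiber k D x) : c = 0 := by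
  simpa [fiber, hx] using hc

variable (k D) in
/-- The representation `P_D`, as an object of the category of pointwise finite-dimensional
representations. -/
noncomputable abbrev lowerObj : A.RepPwf k := ⟨lowerRep k D, pwf_lowerRep k D⟩

lemma isZero_lowerObj_iff : IsZero (lowerObj k D) ↔ ∀ x, x ∉ D := by
  rw [isZero_iff_subsingleton]
  constructor
  · intro h x hx
    have := congrArg Subtype.val
      ((h x).elim (⟨1, mem_fiber hx 1⟩ : fiber k D x) (⟨0, mem_fiber hx 0⟩ : fiber k D x))
    exact one_ne_zero this
  · intro h x
    refine ⟨fun (v w : fiber k D x) => Subtype.ext ?_⟩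
    rw [eq_zero_of_mem_fiber (h x) v.2, eq_zero_of_mem_fiber (h x) w.2]

/-- A compatible family of vectors `v x ∈ V(x)`, `x ∈ D`, determines a morphism `P_D ⟶ V`. -/
noncomputable def lowerRepDesc (V : A.Rep k) (v : ∀ x : A.Pt, V.obj (op x))
    (hv : ∀ ⦃x y⦄ (h : y ≤ x), x ∈ D → tr V h (v x) = v y) : lowerRep k D ⟶ V where
  app x := ModuleCat.ofHom
    ((LinearMap.toSpanSingleton k _ (v x.unop)).comp (fiber k D x.unop).subtype)
  naturality x y f := by
    ext (c : fiber k D x.unop)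
    change c.1 • v y.unop = (tr V (leOfHom f.unop)) (c.1 • v x.unop)
    rw [map_smul]
    by_cases hx : x.unop ∈ D
    · rw [hv _ hx]
    · rw [eq_zero_of_mem_fiber hx c.2, zero_smul, zero_smul]

/-- `P_D` is projective when `D` is directed.  A lift of `P_D ⟶ X` through an epimorphism
`E ⟶ X` is a compatible family of lifts of the images of the basis vectors; it is obtained from an
arbitrary family of lifts by transporting it down from `z ∈ D` to a given point and taking a
generalized limit as `z` increases in `D`. -/
lemma projective_lowerObj (hne : (D : Set A.Pt).Nonempty)
    (hD : DirectedOn (· ≤ ·) (D : Set A.Pt)) : Projective (lowerObj k D) where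
  factors {E X} f e he := by
    classical
    rw [epi_iff_surjective] at he
    have : IsDirectedOrder (D : Set A.Pt) := directedOn_iff_isDirectedOrder.1 hD
    have : Nonempty (D : Set A.Pt) := hne.to_subtype
    have hfd (x : A.Pt) : FiniteDimensional k (E.obj.obj (op x)) := E.property x
    have hfd' (x : A.Pt) : FiniteDimensional k (X.obj.obj (op x)) := X.property x
    obtain ⟨L, hL, hL1⟩ :=
      exists_generalizedLimit (k := k) (Filter.atTop : Filter (D : Set A.Pt))
    -- the images of the basis vectors of `P_D`
    let u (z : (D : Set A.Pt)) : X.obj.obj (op z.1) :=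
      (f.hom.app (op z.1)).hom (⟨1, mem_fiber z.2 1⟩ : fiber k D z.1)
    have hu {z w : (D : Set A.Pt)} (h : w ≤ z) : tr X.obj h (u z) = u w :=
      (app_tr f.hom (show w.1 ≤ z.1 from h) _).symm
    choose c hc using fun z : (D : Set A.Pt) => he z.1 (u z)
    let g (x : A.Pt) (z : (D : Set A.Pt)) : E.obj.obj (op x) :=
      if h : x ≤ z.1 then tr E.obj h (c z) else 0
    let y (x : A.Pt) : E.obj.obj (op x) := vectorLimit L _ (g x)
    have hy ⦃x x' : A.Pt⦄ (h : x' ≤ x) (hx : x ∈ D) : tr E.obj h (y x) = y x' := by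
      refine (map_vectorLimit L _ _).trans (vectorLimit_congr hL ?_)
      filter_upwards [Filter.eventually_ge_atTop (⟨x, hx⟩ : (D : Set A.Pt))] with z hz
      have hz' : x ≤ z.1 := hz
      simp only [g, dif_pos hz', dif_pos (h.trans hz')]
      exact tr_tr _ _ _ _
    refine ⟨ObjectProperty.homMk (lowerRepDesc E.obj y hy), ?_⟩
    ext x (a : fiber k D x.unop)
    change (e.hom.app x).hom (a.1 • y x.unop) = (f.hom.app x).hom a
    by_cases hx : x.unop ∈ D
    · have hey : (e.hom.app x).hom (y x.unop) = u ⟨x.unop, hx⟩ := by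
        refine (map_vectorLimit L _ _).trans
          ((vectorLimit_congr hL ?_).trans (vectorLimit_const hL1 _))
        filter_upwards [Filter.eventually_ge_atTop (⟨x.unop, hx⟩ : (D : Set A.Pt))] with z hz
        have hz' : x.unop ≤ z.1 := hz
        simp only [g, dif_pos hz']
        exact (app_tr e.hom hz' _).trans ((congrArg _ (hc z)).trans (hu hz))
      rw [map_smul, hey]
      exact (map_smul (f.hom.app x).hom a.1 (⟨1, mem_fiber hx 1⟩ : fiber k D x.unop)).symm.trans
        (congrArg (f.hom.app x).hom (Subtype.ext (mul_one a.1)))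
    · have ha : a = 0 := Subtype.ext (eq_zero_of_mem_fiber hx a.2)
      rw [eq_zero_of_mem_fiber hx a.2, zero_smul, map_zero]
      exact (map_zero (f.hom.app x).hom).symm.trans (congrArg (f.hom.app x).hom ha.symm)

/-- The endomorphisms of `P_D` are the scalars when `D` is directed. -/
lemma exists_scalar_of_end (hD : DirectedOn (· ≤ ·) (D : Set A.Pt))
    (e : lowerObj k D ⟶ lowerObj k D) : ∃ c : k, e = c • 𝟙 _ := by
  let s (x : A.Pt) (hx : x ∈ D) : k :=
    ((e.hom.app (op x)).hom (⟨1, mem_fiber hx 1⟩ : fiber k D x) : fiber k D x).1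
  have hs {x y : A.Pt} (h : y ≤ x) (hx : x ∈ D) (hy : y ∈ D) : s y hy = s x hx :=
    congrArg Subtype.val (app_tr e.hom h (⟨1, mem_fiber hx 1⟩ : fiber k D x))
  obtain ⟨c, hc⟩ : ∃ c, ∀ x (hx : x ∈ D), s x hx = c := by
    rcases (D : Set A.Pt).eq_empty_or_nonempty with h | ⟨x, hx⟩
    · exact ⟨0, fun x hx => absurd hx (Set.eq_empty_iff_forall_notMem.1 h x)⟩
    · refine ⟨s x hx, fun y hy => ?_⟩
      obtain ⟨z, hz, hxz, hyz⟩ := hD x hx y hy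
      exact (hs hyz hz hy).trans (hs hxz hz hx).symm
  refine ⟨c, ?_⟩
  ext x (a : fiber k D x.unop)
  refine Subtype.ext ?_
  change ((e.hom.app x).hom a : fiber k D x.unop).1 = c * a.1
  by_cases hx : x.unop ∈ D
  · have ha : a = a.1 • (⟨1, mem_fiber hx 1⟩ : fiber k D x.unop) :=
      Subtype.ext (mul_one a.1).symm
    rw [← hc _ hx, mul_comm]
    conv_lhs => rw [ha]
    exact congrArg Subtype.val (map_smul (e.hom.app x).hom a.1 _)
  · rw [eq_zero_of_mem_fiber hx a.2, mul_zero]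
    exact eq_zero_of_mem_fiber hx (Subtype.property _)

lemma indecomposable_lowerObj (hne : (D : Set A.Pt).Nonempty)
    (hD : DirectedOn (· ≤ ·) (D : Set A.Pt)) : Indecomposable (lowerObj k D) := by
  have hne' : ¬ IsZero (lowerObj k D) := fun h =>
    hne.elim fun x hx => isZero_lowerObj_iff.1 h x hx
  refine ⟨hne', fun Y Z i => ?_⟩
  -- the idempotent projecting onto `Y` is a scalar, hence `0` or `1`
  obtain ⟨c, hc⟩ := exists_scalar_of_end hD (i.hom ≫ biprod.fst ≫ biprod.inl ≫ i.inv)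
  have hY : (1 - c) • 𝟙 Y = 0 := by
    have := congrArg (fun t => biprod.inl ≫ i.inv ≫ t ≫ i.hom ≫ biprod.fst) hc
    simp at this
    rw [sub_smul, one_smul, ← this, sub_self]
  have hZ : c • 𝟙 Z = 0 := by
    have := congrArg (fun t => biprod.inr ≫ i.inv ≫ t ≫ i.hom ≫ biprod.snd) hc
    simpa using this.symm
  by_cases h0 : c = 0
  · left
    rw [IsZero.iff_id_eq_zero]
    simpa [h0] using hY
  · right
    rw [IsZero.iff_id_eq_zero]
    exact (smul_eq_zero_iff_right h0).1 hZ

end LowerSets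

/-! ### Directed lower sets of the orientation -/

section Orientation

variable {A : ContinuousTypeA}

lemma Segment.eq_of_even {n m : ℤ} {y : EReal} (hn : A.Segment n y) (hm : A.Segment m y)
    (h : Even n ↔ Even m) : n = m := by
  rw [Int.even_iff, Int.even_iff] at h
  rcases lt_trichotomy n m with h' | h' | h'
  · have := (hn.eq_of_lt hm h').1
    omega
  · exact h'
  · have := (hm.eq_of_lt hn h').1
    omega

/-- If `x` is strictly below `y`, then some segment contains `x`, `y` and all points above `y`. -/
lemma Prec.exists_segment {x y : EReal} (h : A.Prec x y) (hne : x ≠ y) :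
    ∃ n : ℤ, A.Segment n x ∧ A.Segment n y ∧
      ((Even n ∧ x < y ∧ ∀ z, A.Prec y z → A.Segment n z ∧ y ≤ z) ∨
        (Odd n ∧ y < x ∧ ∀ z, A.Prec y z → A.Segment n z ∧ z ≤ y)) := by
  obtain rfl | ⟨n, hx, hy, h⟩ := h
  · exact absurd rfl hne
  refine ⟨n, hx, hy, h.imp ?_ ?_⟩
  · rintro ⟨he, hle⟩
    have hlt := lt_of_le_of_ne hle hne
    refine ⟨he, hlt, ?_⟩
    rintro z (rfl | ⟨m, hmy, hmz, ⟨he', hle'⟩ | ⟨ho', hle'⟩⟩)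
    · exact ⟨hy, le_rfl⟩
    · obtain rfl := hy.eq_of_even hmy (by tauto)
      exact ⟨hmz, hle'⟩
    · obtain hnm | rfl | hnm := lt_trichotomy n m
      · obtain ⟨rfl, h⟩ := hy.eq_of_lt hmy hnm
        obtain rfl : y = z := le_antisymm (h.le.trans hmz.2.2.1) hle'
        exact ⟨hy, le_rfl⟩
      · exact absurd he (Int.not_even_iff_odd.2 ho')
      · obtain ⟨rfl, h⟩ := hmy.eq_of_lt hy hnm
        exact absurd (h.le.trans hx.2.2.1) (not_le.2 hlt)
  · rintro ⟨ho, hle⟩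
    have hlt := lt_of_le_of_ne hle hne.symm
    refine ⟨ho, hlt, ?_⟩
    rintro z (rfl | ⟨m, hmy, hmz, ⟨he', hle'⟩ | ⟨ho', hle'⟩⟩)
    · exact ⟨hy, le_rfl⟩
    · obtain hnm | rfl | hnm := lt_trichotomy n m
      · obtain ⟨rfl, h⟩ := hy.eq_of_lt hmy hnm
        exact absurd (hx.2.2.2.trans h.ge) (not_le.2 hlt)
      · exact absurd he' (Int.not_even_iff_odd.2 ho)
      · obtain ⟨rfl, h⟩ := hmy.eq_of_lt hy hnm
        obtain rfl : y = z := le_antisymm hle' (hmz.2.2.2.trans h.ge)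
        exact ⟨hy, le_rfl⟩
    · obtain rfl := hy.eq_of_even hmy (by simp only [← Int.not_even_iff_odd] at *; tauto)
      exact ⟨hmz, hle'⟩

/-- The points above a point that is not a sink form a chain. -/
lemma le_total_of_not_isMin {b x y : A.Pt} (hb : ¬ IsMin b) (hx : b ≤ x) (hy : b ≤ y) :
    x ≤ y ∨ y ≤ x := by
  obtain ⟨c, hc⟩ := not_isMin_iff.1 hb
  have hne : (c.val : EReal) ≠ b.val := fun h => hc.ne (Pt.ext (EReal.coe_injective h))
  obtain ⟨n, -, -, ⟨he, -, h⟩ | ⟨ho, -, h⟩⟩ := Prec.exists_segment (A := A) hc.le hne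
  · exact (le_total (x.val : EReal) y.val).imp
      (fun hle => Or.inr ⟨n, (h _ hx).1, (h _ hy).1, Or.inl ⟨he, hle⟩⟩)
      (fun hle => Or.inr ⟨n, (h _ hy).1, (h _ hx).1, Or.inl ⟨he, hle⟩⟩)
  · exact (le_total (x.val : EReal) y.val).symm.imp
      (fun hle => Or.inr ⟨n, (h _ hx).1, (h _ hy).1, Or.inr ⟨ho, hle⟩⟩)
      (fun hle => Or.inr ⟨n, (h _ hy).1, (h _ hx).1, Or.inr ⟨ho, hle⟩⟩)

lemma directedOn_down (a : ℝ) : DirectedOn (· ≤ ·) (A.down a : Set A.Pt) :=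
  fun _ hx _ hy => ⟨⟨a⟩, Or.inl rfl, hx, hy⟩

lemma directedOn_downLeft (a : EReal) : DirectedOn (· ≤ ·) (A.downLeft a : Set A.Pt) := by
  have key {x : A.Pt} (hx : x ∈ A.downLeft a) :
      ∃ n : ℤ, Even n ∧ A.Segment n x.val ∧ A.Segment n a := by
    obtain ⟨h, hlt⟩ := hx
    obtain ⟨n, hn, hna, ⟨he, -⟩ | ⟨-, h', -⟩⟩ := h.exists_segment hlt.ne
    · exact ⟨n, he, hn, hna⟩
    · exact absurd h' hlt.not_gt
  intro x hx y hy
  obtain ⟨n, he, hnx, hna⟩ := key hx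
  obtain ⟨m, he', hmy, hma⟩ := key hy
  obtain rfl := hna.eq_of_even hma (by tauto)
  rcases le_total (x.val : EReal) y.val with h | h
  · exact ⟨y, hy, Or.inr ⟨n, hnx, hmy, Or.inl ⟨he, h⟩⟩, le_rfl⟩
  · exact ⟨x, hx, le_rfl, Or.inr ⟨n, hmy, hnx, Or.inl ⟨he, h⟩⟩⟩

lemma directedOn_downRight (a : EReal) : DirectedOn (· ≤ ·) (A.downRight a : Set A.Pt) := by
  have key {x : A.Pt} (hx : x ∈ A.downRight a) :
      ∃ n : ℤ, ¬ Even n ∧ A.Segment n x.val ∧ A.Segment n a := by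
    obtain ⟨h, hlt⟩ := hx
    obtain ⟨n, hn, hna, ⟨-, h', -⟩ | ⟨ho, -⟩⟩ := h.exists_segment hlt.ne'
    · exact absurd h' hlt.not_gt
    · exact ⟨n, Int.not_even_iff_odd.2 ho, hn, hna⟩
  intro x hx y hy
  obtain ⟨n, ho, hnx, hna⟩ := key hx
  obtain ⟨m, ho', hmy, hma⟩ := key hy
  obtain rfl := hna.eq_of_even hma (by tauto)
  have ho := Int.not_even_iff_odd.1 ho
  rcases le_total (x.val : EReal) y.val with h | h
  · exact ⟨x, hx, le_rfl, Or.inr ⟨n, hmy, hnx, Or.inr ⟨ho, h⟩⟩⟩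
  · exact ⟨y, hy, Or.inr ⟨n, hnx, hmy, Or.inr ⟨ho, h⟩⟩, le_rfl⟩

/-- The nonempty directed lower sets are those defining the representations `P_a`, `P_{a)}` and
`P_{(a}`. -/
lemma eq_down_of_directedOn {D : LowerSet A.Pt} (hne : (D : Set A.Pt).Nonempty)
    (hD : DirectedOn (· ≤ ·) (D : Set A.Pt)) :
    (∃ a : ℝ, D = A.down a) ∨ (∃ a : EReal, D = A.downLeft a) ∨
      (∃ a : EReal, D = A.downRight a) := by
  by_cases hmax : ∃ a ∈ D, ∀ x ∈ D, x ≤ a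
  · obtain ⟨a, ha, hx⟩ := hmax
    exact Or.inl ⟨a.val, SetLike.ext fun x => ⟨hx x, fun h => D.lower h ha⟩⟩
  right
  have hgt {x : A.Pt} (hx : x ∈ D) : ∃ y ∈ D, x < y := by
    by_contra! h
    refine hmax ⟨x, hx, fun y hy => ?_⟩
    obtain ⟨z, hz, hxz, hyz⟩ := hD x hx y hy
    obtain rfl := eq_of_le_of_not_lt hxz (h z hz)
    exact hyz
  obtain ⟨b, hb⟩ := hne
  obtain ⟨y, hy, hby⟩ := hgt hb
  have hne : (b.val : EReal) ≠ y.val := fun h => hby.ne (Pt.ext (EReal.coe_injective h))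
  -- the part of `D` above `y` is cofinal, and contained in a single segment
  have hcof {x : A.Pt} (hx : x ∈ D) : ∃ z ∈ D, y ≤ z ∧ x < z := by
    obtain ⟨w, hw, hxw, hyw⟩ := hD x hx y hy
    obtain ⟨z, hz, hwz⟩ := hgt hw
    exact ⟨z, hz, hyw.trans hwz.le, hxw.trans_lt hwz⟩
  let T : Set EReal := (fun z : A.Pt => (z.val : EReal)) '' {z | z ∈ D ∧ y ≤ z}
  obtain ⟨n, -, hny, ⟨he, -, h⟩ | ⟨ho, -, h⟩⟩ := Prec.exists_segment (A := A) hby.le hne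
  · left
    have hle {z : A.Pt} (hz : z ∈ D) (hyz : y ≤ z) : (z.val : EReal) ≤ sSup T :=
      le_sSup ⟨z, ⟨hz, hyz⟩, rfl⟩
    have hs : A.Segment n (sSup T) := by
      refine ⟨hny.1, hny.2.1, hny.2.2.1.trans (hle hy le_rfl), sSup_le ?_⟩
      rintro _ ⟨z, ⟨hz, hyz⟩, rfl⟩
      exact (h _ hyz).1.2.2.2
    have hlt {z : A.Pt} (hz : z ∈ D) (hyz : y ≤ z) : (z.val : EReal) < sSup T := by
      obtain ⟨w, hw, hyw, hzw⟩ := hcof hz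
      refine lt_of_le_of_ne (hle hz hyz) fun heq => hzw.not_ge ?_
      exact Or.inr ⟨n, (h _ hyw).1, (h _ hyz).1, Or.inl ⟨he, (hle hw hyw).trans heq.ge⟩⟩
    refine ⟨sSup T, SetLike.ext fun x => ⟨fun hx => ?_, ?_⟩⟩
    · obtain ⟨z, hz, hyz, hxz⟩ := hcof hx
      have hza : A.Prec (z.val : EReal) (sSup T) :=
        Or.inr ⟨n, (h _ hyz).1, hs, Or.inl ⟨he, hle hz hyz⟩⟩
      exact ⟨Prec.trans hxz.le hza, Prec.lt_of_lt hxz.le hza (hlt hz hyz)⟩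
    · rintro ⟨hxa, hxlt⟩
      obtain ⟨m, hmx, hma, ⟨he', -⟩ | ⟨-, h', -⟩⟩ := hxa.exists_segment hxlt.ne
      · obtain rfl := hma.eq_of_even hs (by tauto)
        obtain ⟨_, ⟨z, ⟨hz, hyz⟩, rfl⟩, hxz⟩ := lt_sSup_iff.1 hxlt
        exact D.lower (show x ≤ z from Or.inr ⟨m, hmx, (h _ hyz).1, Or.inl ⟨he, hxz.le⟩⟩) hz
      · exact absurd h' hxlt.not_gt
  · right
    have hle {z : A.Pt} (hz : z ∈ D) (hyz : y ≤ z) : sInf T ≤ (z.val : EReal) :=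
      sInf_le ⟨z, ⟨hz, hyz⟩, rfl⟩
    have hs : A.Segment n (sInf T) := by
      refine ⟨hny.1, hny.2.1, le_sInf ?_, (hle hy le_rfl).trans hny.2.2.2⟩
      rintro _ ⟨z, ⟨hz, hyz⟩, rfl⟩
      exact (h _ hyz).1.2.2.1
    have hlt {z : A.Pt} (hz : z ∈ D) (hyz : y ≤ z) : sInf T < (z.val : EReal) := by
      obtain ⟨w, hw, hyw, hzw⟩ := hcof hz
      refine lt_of_le_of_ne (hle hz hyz) fun heq => hzw.not_ge ?_
      exact Or.inr ⟨n, (h _ hyw).1, (h _ hyz).1, Or.inr ⟨ho, heq.ge.trans (hle hw hyw)⟩⟩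
    refine ⟨sInf T, SetLike.ext fun x => ⟨fun hx => ?_, ?_⟩⟩
    · obtain ⟨z, hz, hyz, hxz⟩ := hcof hx
      have hza : A.Prec (z.val : EReal) (sInf T) :=
        Or.inr ⟨n, (h _ hyz).1, hs, Or.inr ⟨ho, hle hz hyz⟩⟩
      exact ⟨Prec.trans hxz.le hza, Prec.gt_of_gt hxz.le hza (hlt hz hyz)⟩
    · rintro ⟨hxa, hxlt⟩
      obtain ⟨m, hmx, hma, ⟨-, h', -⟩ | ⟨ho', -⟩⟩ := hxa.exists_segment hxlt.ne'
      · exact absurd h' hxlt.not_gt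
      · obtain rfl := hma.eq_of_even hs (by simp only [← Int.not_even_iff_odd] at *; tauto)
        obtain ⟨_, ⟨z, ⟨hz, hyz⟩, rfl⟩, hxz⟩ := sInf_lt_iff.1 hxlt
        exact D.lower (show x ≤ z from Or.inr ⟨m, hmx, (h _ hyz).1, Or.inr ⟨ho, hxz.le⟩⟩) hz

end Orientation

/-! ### Indecomposable projective representations -/

section Classification

variable {k : Type u} [Field k] {A : ContinuousTypeA}

/-- For a functional `φ` on `V(b)`, the subspace of `V(x) × P_D(x)` of the pairs `(v, c)` such
that `φ` takes the value `c` at the image of `v` in `V(b)`, a condition that is empty unless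
`b ≤ x`. -/
def fiberProduct (D : LowerSet A.Pt) (V : A.Rep k) {b : A.Pt} (φ : Module.Dual k (V.obj (op b)))
    (x : A.Pt) : Submodule k (V.obj (op x) × fiber k D x) where
  carrier := {p | ∀ h : b ≤ x, φ (tr V h p.1) = p.2.1}
  add_mem' hp hq h := by simp [← hp h, ← hq h]
  zero_mem' h := by simp
  smul_mem' c p hp h := by simp [← hp h]

/-- The subspaces `fiberProduct` form a representation: the fibre product of `V` and `P_D` over
the representation that is `k` on the points above `b`. -/
noncomputable def fiberProductRep (D : LowerSet A.Pt) (V : A.Rep k) {b : A.Pt}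
    (φ : Module.Dual k (V.obj (op b))) : A.Rep k where
  obj x := ModuleCat.of k (fiberProduct D V φ x.unop)
  map {x y} f := ModuleCat.ofHom <|
    ((V.map f).hom.prodMap (Submodule.inclusion (fiber_mono k D (leOfHom f.unop)))).restrict
      fun p hp h => (congrArg φ (tr_tr V (leOfHom f.unop) h p.1)).trans (hp _)
  map_id x := by
    refine ModuleCat.hom_ext (LinearMap.ext fun p => Subtype.ext (Prod.ext ?_ rfl))
    exact congrArg (fun t => t.hom p.1.1) (V.map_id x)
  map_comp f g := by
    refine ModuleCat.hom_ext (LinearMap.ext fun p => Subtype.ext (Prod.ext ?_ rfl))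
    exact congrArg (fun t => t.hom p.1.1) (V.map_comp f g)

/-- If `V` is projective, a functional `φ` on `V(b)` extends to a morphism `V ⟶ P_D`, for every
lower set `D` containing all points `x` above `b` such that `φ` is nonzero on the image of
`V(x)`. -/
lemma exists_hom_lowerObj (V : A.RepPwf k) [Projective V] {b : A.Pt}
    (φ : Module.Dual k (V.obj.obj (op b))) (D : LowerSet A.Pt)
    (hD : ∀ x (h : b ≤ x), (∃ v, φ (tr V.obj h v) ≠ 0) → x ∈ D) :
    ∃ f : V ⟶ lowerObj k D, ∀ x (h : b ≤ x) (v : V.obj.obj (op x)),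
      ((f.hom.app (op x)).hom v : fiber k D x).1 = φ (tr V.obj h v) := by
  classical
  have hfd (x : A.Pt) : FiniteDimensional k (V.obj.obj (op x)) := V.property x
  let E : A.RepPwf k := ⟨fiberProductRep D V.obj φ, fun x =>
    inferInstanceAs (FiniteDimensional k (fiberProduct D V.obj φ x))⟩
  let p : E ⟶ V := ObjectProperty.homMk
    { app x := ModuleCat.ofHom
        ((LinearMap.fst k _ _).comp (fiberProduct D V.obj φ x.unop).subtype)
      naturality _ _ _ := rfl }
  let q : E ⟶ lowerObj k D := ObjectProperty.homMk
    { app x := ModuleCat.ofHom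
        ((LinearMap.snd k _ _).comp (fiberProduct D V.obj φ x.unop).subtype)
      naturality _ _ _ := rfl }
  have hp : Epi p := by
    refine (epi_iff_surjective p).2 fun x v => ?_
    let c : k := if h : b ≤ x then φ (tr V.obj h v) else 0
    have hc : c ∈ fiber k D x := by
      by_cases hx : x ∈ D
      · exact mem_fiber hx c
      · have : c = 0 := by
          by_cases h : b ≤ x
          · simp only [c, dif_pos h]
            by_contra h0
            exact hx (hD x h ⟨v, h0⟩)
          · simp only [c, dif_neg h]
        rw [this]
        exact Submodule.zero_mem _
    exact ⟨(⟨(v, ⟨c, hc⟩), fun h => (dif_pos h : c = _).symm⟩ : fiberProduct D V.obj φ x), rfl⟩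
  refine ⟨Projective.factorThru (𝟙 V) p ≫ q, fun x h v => ?_⟩
  let e : fiberProduct D V.obj φ x := ((Projective.factorThru (𝟙 V) p).hom.app (op x)).hom v
  have he : e.1.1 = v :=
    congrArg (fun t : V ⟶ V => (t.hom.app (op x)).hom v) (Projective.factorThru_comp (𝟙 V) p)
  change e.1.2.1 = _
  rw [← e.2 h, he]

/-- An indecomposable projective representation is `P_D` for a nonempty directed lower set `D`:
given a nonzero functional `φ` on some `V(b)`, let `D` be generated by the points `x` above `b`
such that `φ` is nonzero on the image of `V(x)`; then `V` maps onto `P_D`.  These points form a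
chain if `b` is not a sink.  If `V` is concentrated in the sinks, `D` consists of `b` only. -/
lemma exists_iso_lowerObj (V : A.RepPwf k) (hV : Indecomposable V) [Projective V] :
    ∃ D : LowerSet A.Pt, (D : Set A.Pt).Nonempty ∧ DirectedOn (· ≤ ·) (D : Set A.Pt) ∧
      Nonempty (V ≅ lowerObj k D) := by
  obtain ⟨b, hb, hchain⟩ : ∃ b : A.Pt, Nontrivial (V.obj.obj (op b)) ∧
      ∀ x y, b ≤ x → b ≤ y → Nontrivial (V.obj.obj (op x)) → Nontrivial (V.obj.obj (op y)) →
        x ≤ y ∨ y ≤ x := by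
    by_cases h : ∃ b : A.Pt, ¬ IsMin b ∧ Nontrivial (V.obj.obj (op b))
    · obtain ⟨b, hmin, hb⟩ := h
      exact ⟨b, hb, fun x y hx hy _ _ => le_total_of_not_isMin hmin hx hy⟩
    · push Not at h
      obtain ⟨b, hb⟩ : ∃ b : A.Pt, Nontrivial (V.obj.obj (op b)) := by
        by_contra! hn
        exact hV.1 ((isZero_iff_subsingleton V).2 hn)
      have hmin (x : A.Pt) (hx : Nontrivial (V.obj.obj (op x))) : IsMin x := by
        by_contra hx'
        exact not_subsingleton _ (h x hx')
      refine ⟨b, hb, fun x y hx hy hx' hy' => Or.inl ?_⟩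
      exact (hmin x hx' hx).trans hy
  obtain ⟨w, hw⟩ := exists_ne (0 : V.obj.obj (op b))
  obtain ⟨φ, hφ⟩ : ∃ φ : Module.Dual k (V.obj.obj (op b)), φ w ≠ 0 := by
    by_contra! h
    exact hw ((Module.forall_dual_apply_eq_zero_iff k w).1 h)
  let U : Set A.Pt := {x | ∃ h : b ≤ x, ∃ v, φ (tr V.obj h v) ≠ 0}
  have hbU : b ∈ U := ⟨le_rfl, w, by rwa [tr_self]⟩
  have hUV {x : A.Pt} : x ∈ U → Nontrivial (V.obj.obj (op x)) := by
    rintro ⟨_, v, hv⟩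
    exact ⟨v, 0, by rintro rfl; simp at hv⟩
  have hne : ((lowerClosure U : LowerSet A.Pt) : Set A.Pt).Nonempty :=
    ⟨b, subset_lowerClosure hbU⟩
  have hdir : DirectedOn (· ≤ ·) ((lowerClosure U : LowerSet A.Pt) : Set A.Pt) := by
    rintro x ⟨x', hx', hxx'⟩ y ⟨y', hy', hyy'⟩
    rcases hchain x' y' hx'.1 hy'.1 (hUV hx') (hUV hy') with h | h
    · exact ⟨y', subset_lowerClosure hy', hxx'.trans h, hyy'⟩
    · exact ⟨x', subset_lowerClosure hx', hxx', hyy'.trans h⟩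
  refine ⟨lowerClosure U, hne, hdir, ?_⟩
  obtain ⟨f, hf⟩ := exists_hom_lowerObj V φ (lowerClosure U)
    fun x h hx => subset_lowerClosure ⟨h, hx⟩
  have := projective_lowerObj (k := k) hne hdir
  have : Epi f := by
    refine (epi_iff_surjective f).2 fun y (c : fiber k (lowerClosure U) y) => ?_
    by_cases hy : y ∈ lowerClosure U
    · obtain ⟨x, ⟨hbx, v, hv⟩, hyx⟩ := hy
      have h1 : ((f.hom.app (op y)).hom (tr V.obj hyx v) : fiber k (lowerClosure U) y).1 =
          φ (tr V.obj hbx v) :=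
        (congrArg Subtype.val (app_tr f.hom hyx v)).trans (hf x hbx v)
      refine ⟨(c.1 / φ (tr V.obj hbx v)) • tr V.obj hyx v, ?_⟩
      refine (map_smul (f.hom.app (op y)).hom _ _).trans (Subtype.ext ?_)
      change c.1 / φ (tr V.obj hbx v) * _ = c.1
      rw [h1, div_mul_cancel₀ _ hv]
    · refine ⟨0, (map_zero _).trans (Subtype.ext ?_)⟩
      exact (eq_zero_of_mem_fiber hy c.2).symm
  exact nonempty_iso_of_epi hV (indecomposable_lowerObj hne hdir).1 f

/-- The nonzero representations among the `P_D` with `D` directed are indecomposable and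
projective, and so are the representations isomorphic to them. -/
lemma indecomposable_and_projective_of_iso {V : A.RepPwf k} (hV : ¬ IsZero V)
    {D : LowerSet A.Pt} (hD : DirectedOn (· ≤ ·) (D : Set A.Pt)) (i : V ≅ lowerObj k D) :
    Indecomposable V ∧ Projective V := by
  have hne : (D : Set A.Pt).Nonempty := by
    by_contra! h
    exact hV (i.isZero_iff.2 (isZero_lowerObj_iff.2 (Set.eq_empty_iff_forall_notMem.1 h)))
  exact ⟨⟨hV, fun Y Z j => (indecomposable_lowerObj hne hD).2 Y Z (i.symm ≪≫ j)⟩,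
    Projective.of_iso i.symm (projective_lowerObj hne hD)⟩

end Classification

end ContinuousTypeA

/-- Classification of the indecomposable projective objects of the category of pointwise
finite-dimensional representations of a quiver of continuous type `A`: up to isomorphism they are
exactly the nonzero ones among `P_a`, `P_{a)}` and `P_{(a}`. -/
theorem mainTheorem3 {k : Type u} [Field k] (A : ContinuousTypeA) (V : A.RepPwf k) :
    (Indecomposable V ∧ Projective V) ↔
      (¬ IsZero V ∧
        ((∃ a : ℝ, Nonempty (V ≅ A.P k a)) ∨
          (∃ a : EReal, Nonempty (V ≅ A.PLeft k a)) ∨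
          (∃ a : EReal, Nonempty (V ≅ A.PRight k a)))) := by
  constructor
  · rintro ⟨hV, hP⟩
    obtain ⟨D, hne, hD, hiso⟩ := ContinuousTypeA.exists_iso_lowerObj V hV
    refine ⟨hV.1, ?_⟩
    rcases ContinuousTypeA.eq_down_of_directedOn hne hD with ⟨a, rfl⟩ | ⟨a, rfl⟩ | ⟨a, rfl⟩
    · exact Or.inl ⟨a, hiso⟩
    · exact Or.inr (Or.inl ⟨a, hiso⟩)
    · exact Or.inr (Or.inr ⟨a, hiso⟩)
  · rintro ⟨hV, ⟨a, ⟨i⟩⟩ | ⟨a, ⟨i⟩⟩ | ⟨a, ⟨i⟩⟩⟩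
    · exact ContinuousTypeA.indecomposable_and_projective_of_iso hV
        (ContinuousTypeA.directedOn_down a) i
    · exact ContinuousTypeA.indecomposable_and_projective_of_iso hV
        (ContinuousTypeA.directedOn_downLeft a) i
    · exact ContinuousTypeA.indecomposable_and_projective_of_iso hV
        (ContinuousTypeA.directedOn_downRight a) i
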